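/- Let $f:\mathbb R^n\to\mathbb R^n$ and $B\in\mathbb R^{n\times m}$, and consider the system $\dot x=f(x)+Bu$. Suppose that $f(x)=AZ(x)$ for some matrix $A\in\mathbb R^{n\times s}$, where $s\ge n$, $Z(x)=\begin{bmatrix}x\\ Q(x)\end{bmatrix}$ and $Q:\mathbb R^n\to\mathbb R^{s-n}$ is continuously differentiable. Let samples $x_i\in\mathbb R^n$, $u_i\in\mathbb R^m$, $\dot x_i\in\mathbb R^n$ satisfy $\dot x_i=f(x_i)+Bu_i$ for $i=0,\dots,T-1$, and set $$U_0=[u_0\ \cdots\ u_{T-1}],\qquad X_1=[\dot x_0\ \cdots\ \dot x_{T-1}],\qquad Z_0=[Z(x_0)\ \cdots\ Z(x_{T-1})].$$ Let $\mathcal X\subseteq\mathbb R^n$ and $R_Q\in\mathbb R^{n\times\tau}$ be such that $\frac{\partial Q}{\partial x}(x)^\top\frac{\partial Q}{\partial x}(x)\preceq R_QR_Q^\top$ for all $x\in\mathcal X$. Suppose that a symmetric matrix $P\succ0$ in $\mathbb R^{n\times n}$, matrices $Y_1\in\mathbb R^{T\times n}$, $G_2\in\mathbb R^{T\times(s-n)}$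 and a real number $\alpha>0$ satisfy $$Z_0Y_1=\begin{bmatrix}P\\0\end{bmatrix},\qquad Z_0G_2=\begin{bmatrix}0\\I_{s-n}\end{bmatrix},\qquad \begin{bmatrix}X_1Y_1+(X_1Y_1)^\top+\alpha I_n & X_1G_2 & PR_Q\\ (X_1G_2)^\top & -I_{s-n} & 0\\ R_Q^\top P & 0 & -I_\tau\end{bmatrix}\preceq0,$$ let $K=U_0\begin{bmatrix}Y_1P^{-1} & G_2\end{bmatrix}$, and consider the closed-loop system $$\dot x=(A+BK)Z(x).\tag{$*$}$$ Assume that either (i) $\mathcal X$ is nonempty, convex, closed and forward invariant for $(*)$ (every solution that starts in $\mathcal X$ stays in $\mathcal X$ as long as it exists), and $(*)$ is forward complete on $\mathcal X$ (from every point of $\mathcal X$ a solution exists for all future time), or (ii) $\mathcal X=\mathbb R^n$. Then $(*)$ has a unique equilibrium point $x_*$ in $\mathcal X$. Moreover, $x_*$ is uniformly exponentially stable for $(*)$: there are $\delta,c,\lambda>0$ such that, for every initial time $t_0$, every solution of $(*)$ with $|x(t_0)-x_*|<\delta$ extends to $[t_0,\infty)$ and satisfies $|x(t)-x_*|\le c\,e^{-\lambda(t-t_0)}|x(t_0)-x_*|$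 for all $t\ge t_0$. Finally, every solution of $(*)$ initialized in $\mathcal X$ converges uniformly exponentially to $x_*$: there are $c',\lambda'>0$ such that, for every $t_0$, every solution with $x(t_0)\in\mathcal X$ extends to $[t_0,\infty)$ and satisfies $|x(t)-x_*|\le c'e^{-\lambda'(t-t_0)}|x(t_0)-x_*|$ for all $t\ge t_0$. -/

import Mathlib

open Matrix

/-- The Euclidean space `ℝᵏ`, with the 2-norm. -/
abbrev Vec (k : ℕ) : Type := EuclideanSpace ℝ (Fin k)

section Dictionary

variable {n m q τ T : ℕ}

/-- The dictionary `Z(x) = [x ; Q(x)]`, a vector with `s = n + q` entries. -/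
def dictionary (Q : Vec n → Vec q) (x : Vec n) : Fin n ⊕ Fin q → ℝ :=
  Sum.elim (fun i => x i) (fun j => Q x j)

/-- The Jacobian matrix `∂Q/∂x (x)`. -/
noncomputable def jacobian (Q : Vec n → Vec q) (x : Vec n) : Matrix (Fin q) (Fin n) ℝ :=
  Matrix.of fun i j => fderiv ℝ Q x (EuclideanSpace.single j 1) i

/-- The bound `(∂Q/∂x)ᵀ (∂Q/∂x) ⪯ R_Q R_Qᵀ` at every point of `X`. -/
def JacobianBound (Q : Vec n → Vec q) (RQ : Matrix (Fin n) (Fin τ) ℝ) (X : Set (Vec n)) : Prop :=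
  ∀ x ∈ X, (RQ * RQᵀ - (jacobian Q x)ᵀ * jacobian Q x).PosSemidef

/-- The matrix whose columns are the given samples. -/
def sampleMatrix {k : ℕ} (v : Fin T → Vec k) : Matrix (Fin k) (Fin T) ℝ :=
  Matrix.of fun i t => v t i

/-- The matrix whose columns are the dictionary evaluated at the state samples. -/
def dictionaryMatrix (Q : Vec n → Vec q) (x : Fin T → Vec n) :
    Matrix (Fin n ⊕ Fin q) (Fin T) ℝ :=
  Matrix.of fun i t => dictionary Q (x t) i

/-- The symmetric block matrix of the linear matrix inequality. -/
def lmiMatrix (X₁ : Matrix (Fin n) (Fin T) ℝ) (RQ : Matrix (Fin n) (Fin τ) ℝ)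
    (P : Matrix (Fin n) (Fin n) ℝ) (Y₁ : Matrix (Fin T) (Fin n) ℝ)
    (G₂ : Matrix (Fin T) (Fin q) ℝ) (α : ℝ) :
    Matrix ((Fin n ⊕ Fin q) ⊕ Fin τ) ((Fin n ⊕ Fin q) ⊕ Fin τ) ℝ :=
  fromBlocks
    (fromBlocks
      (X₁ * Y₁ + (X₁ * Y₁)ᵀ + α • (1 : Matrix (Fin n) (Fin n) ℝ)) (G₂ᵀ * X₁ᵀ)ᵀ
      (G₂ᵀ * X₁ᵀ) (-1))
    (fromRows (RQᵀ * P)ᵀ 0)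
    (fromCols (RQᵀ * P) 0)
    (-1)

/-- `(P, Y₁, G₂, α)` is a feasible point of the semidefinite program given by the data matrices
`X₁`, `Z₀` and the bound `R_Q`. -/
structure SDPFeasible (X₁ : Matrix (Fin n) (Fin T) ℝ) (Z₀ : Matrix (Fin n ⊕ Fin q) (Fin T) ℝ)
    (RQ : Matrix (Fin n) (Fin τ) ℝ) (P : Matrix (Fin n) (Fin n) ℝ)
    (Y₁ : Matrix (Fin T) (Fin n) ℝ) (G₂ : Matrix (Fin T) (Fin q) ℝ) (α : ℝ) : Prop where
  alpha_pos : 0 < α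
  posDef : P.PosDef
  consistency_left : Z₀ * Y₁ = fromRows P 0
  lmi : (-(lmiMatrix X₁ RQ P Y₁ G₂ α)).PosSemidef
  consistency_right : Z₀ * G₂ = fromRows 0 1

/-- The controller gain `K = U₀ [Y₁ P⁻¹  G₂]`. -/
noncomputable def gain (U₀ : Matrix (Fin m) (Fin T) ℝ) (P : Matrix (Fin n) (Fin n) ℝ)
    (Y₁ : Matrix (Fin T) (Fin n) ℝ) (G₂ : Matrix (Fin T) (Fin q) ℝ) :
    Matrix (Fin m) (Fin n ⊕ Fin q) ℝ :=
  U₀ * fromCols (Y₁ * P⁻¹) G₂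

/-- The closed-loop vector field `x ↦ (A + B K) Z(x)`. -/
def closedLoop (A : Matrix (Fin n) (Fin n ⊕ Fin q) ℝ) (B : Matrix (Fin n) (Fin m) ℝ)
    (K : Matrix (Fin m) (Fin n ⊕ Fin q) ℝ) (Q : Vec n → Vec q) (x : Vec n) : Vec n :=
  WithLp.toLp 2 ((A + B * K) *ᵥ dictionary Q x)

end Dictionary

section Dynamics

variable {n : ℕ}

/-- `x` is a solution of `ẋ = F(x)`, `x(t₀) = ξ`, on the interval `J`, whose left endpoint `t₀`
belongs to `J`. The interval may be bounded or unbounded, open or closed on the right. -/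
structure IsForwardSolution (F : Vec n → Vec n) (t₀ : ℝ) (ξ : Vec n) (J : Set ℝ)
    (x : ℝ → Vec n) : Prop where
  ordConnected : J.OrdConnected
  isLeast : IsLeast J t₀
  initial : x t₀ = ξ
  solves : IsIntegralCurveOn x (fun _ => F) J

/-- Solutions that start in `X` stay in `X` as long as they exist. -/
def ForwardInvariant (F : Vec n → Vec n) (X : Set (Vec n)) : Prop :=
  ∀ (t₀ : ℝ), ∀ ξ ∈ X, ∀ (J : Set ℝ) (x : ℝ → Vec n),
    IsForwardSolution F t₀ ξ J x → ∀ t ∈ J, x t ∈ X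

/-- From every initial condition in `X` there is a solution on `[t₀, ∞)`. -/
def ForwardComplete (F : Vec n → Vec n) (X : Set (Vec n)) : Prop :=
  ∀ (t₀ : ℝ), ∀ ξ ∈ X, ∃ x : ℝ → Vec n, IsForwardSolution F t₀ ξ (Set.Ici t₀) x

/-- All solutions that start in `S` exist for all future time and converge to `p` exponentially,
with constants that depend neither on the initial time nor on the initial state. -/
def UniformExpConverges (F : Vec n → Vec n) (S : Set (Vec n)) (p : Vec n) : Prop :=
  ForwardComplete F S ∧
    ∃ c > 0, ∃ r > 0, ∀ (t₀ : ℝ), ∀ ξ ∈ S, ∀ (J : Set ℝ) (x : ℝ → Vec n),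
      IsForwardSolution F t₀ ξ J x →
        ∀ t ∈ J, ‖x t - p‖ ≤ c * Real.exp (-r * (t - t₀)) * ‖ξ - p‖

/-- `p` is uniformly exponentially stable: the estimate holds for all solutions that start in some
ball of `ℝⁿ` centred at `p`. -/
def UniformExpStable (F : Vec n → Vec n) (p : Vec n) : Prop :=
  ∃ δ > 0, UniformExpConverges F (Metric.ball p δ) p

end Dynamics

/-! The closed loop is contracting in the metric `P⁻¹`. Since the data equations make `[Y₁P⁻¹ G₂]` a
right inverse of `Z₀`, the unknown `A + BK` equals `[X₁Y₁P⁻¹ X₁G₂]` (`add_mul_gain_eq`). The matrix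
inequality and the Jacobian bound then give `⟪P⁻¹v, DF(x)v⟫ ≤ -κ⟪P⁻¹v, v⟫` on `X` for some `κ > 0`
(`SDPFeasible.quadratic_le`).

Integrating along segments of the convex set `X` turns this into strong monotonicity of `F`, so `V =
⟪P⁻¹(x - y), x - y⟫` decays exponentially along two solutions in `X`. Comparing a solution with its
own time translates shows that it is Cauchy at integer times, and its limit is an equilibrium
(`exists_equilibrium`).

Stability in a full neighbourhood, which may leave `X`, uses only the linearization at the
equilibrium and an invariant ellipsoid (`uniformExpStable_of_fderiv`). On the whole space,
completeness is also derived from contraction, by trapping solutions in large ellipsoids. -/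

open Set Filter Topology in
/-- A nonnegative function satisfying `V' ≤ -2κV` while `V < r` decays exponentially. -/
theorem exp_decay {V V' : ℝ → ℝ} {a b r κ : ℝ} (hκ : 0 < κ) (hV0 : ∀ t, 0 ≤ V t)
    (hc : ContinuousOn V (Icc a b))
    (hd : ∀ t ∈ Ico a b, HasDerivWithinAt V (V' t) (Ici t) t) (ha : V a < r)
    (hb : ∀ t ∈ Ico a b, V t < r → V' t ≤ -(2 * κ) * V t) :
    ∀ t ∈ Icc a b, V t ≤ V a * Real.exp (-κ * (t - a)) := by
  intro t ht
  -- The barrier argument needs a strict inequality of derivatives at contact: `ε > 0` forces `V >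
  -- 0` there, and the slower rate `κ` in place of `2κ` supplies the gap. The bound `ε < r - V a`
  -- keeps the barrier below `r`, so `hb` applies.
  have key : ∀ ε ∈ Ioo 0 (r - V a), V t ≤ (V a + ε) * Real.exp (-κ * (t - a)) := by
    rintro ε ⟨hε, hεr⟩
    refine image_le_of_deriv_right_lt_deriv_boundary (f := V) (f' := V')
      (B := fun t => (V a + ε) * Real.exp (-κ * (t - a)))
      (B' := fun t => (V a + ε) * (Real.exp (-κ * (t - a)) * (-κ * 1)))
      hc hd (by simpa using hε.le) (fun s => ?_) (fun s hs hVs => ?_) ht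
    · exact ((((hasDerivAt_id s).sub_const a).const_mul (-κ)).exp).const_mul _
    · have hpos : 0 < V a + ε := by linarith [hV0 a]
      have hexp : Real.exp (-κ * (s - a)) ≤ 1 :=
        Real.exp_le_one_iff.2 (by nlinarith [hs.1])
      have hVpos : 0 < V s := by rw [hVs]; positivity
      have hVr : V s < r := by rw [hVs]; nlinarith
      have := hb s hs hVr
      have h2 : (V a + ε) * (Real.exp (-κ * (s - a)) * (-κ * 1)) = -κ * V s := by
        rw [hVs]; ring
      rw [h2]; nlinarith
  have hlim : Tendsto (fun ε => (V a + ε) * Real.exp (-κ * (t - a))) (𝓝[>] 0)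
      (𝓝 ((V a + 0) * Real.exp (-κ * (t - a)))) :=
    (Continuous.tendsto (by fun_prop) 0).mono_left nhdsWithin_le_nhds
  rw [add_zero] at hlim
  refine ge_of_tendsto hlim ?_
  filter_upwards [Ioo_mem_nhdsGT (sub_pos.2 ha)] with ε hε using key ε hε

/-! ### Global existence for bounded Lipschitz fields -/

section Existence

open Set Metric NNReal

variable {E : Type*} [NormedAddCommGroup E] [NormedSpace ℝ E] [CompleteSpace E]

/-- A bounded, globally Lipschitz vector field has solutions for all future time. -/
theorem exists_isIntegralCurveOn_Ici {G : E → E} {K L : ℝ≥0} (hG : LipschitzWith K G)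
    (hL : ∀ x, ‖G x‖ ≤ L) (t₀ : ℝ) (ξ : E) :
    ∃ x : ℝ → E, x t₀ = ξ ∧ IsIntegralCurveOn x (fun _ => G) (Ici t₀) := by
  have hloc : ∀ N : ℕ, ∃ x : ℝ → E, x t₀ = ξ ∧
      ∀ t ∈ Icc t₀ (t₀ + N), HasDerivWithinAt x (G (x t)) (Icc t₀ (t₀ + N)) t := by
    intro N
    have hN : (0 : ℝ) ≤ N := N.cast_nonneg
    -- With speed at most `L`, a curve cannot leave the ball of radius `L * N` within time `N`.
    have hPL : IsPicardLindelof (fun _ => G) (tmin := t₀) (tmax := t₀ + N)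
        ⟨t₀, by simp⟩ ξ (L * N) 0 L K :=
      IsPicardLindelof.of_time_independent (fun x _ => hL x) hG.lipschitzOnWith (by simp)
    exact hPL.exists_eq_forall_mem_Icc_hasDerivWithinAt₀
  choose γ hγ0 hγ using hloc
  have hright : ∀ N : ℕ, ∀ t ∈ Ico t₀ (t₀ + N),
      HasDerivWithinAt (γ N) (G (γ N t)) (Ici t) t := fun N t ht =>
    (hγ N t ⟨ht.1, ht.2.le⟩).mono_of_mem_nhdsWithin
      (Filter.mem_of_superset (Icc_mem_nhdsGE ht.2) (Icc_subset_Icc_left ht.1))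
  have huniq : ∀ N M : ℕ, N ≤ M → EqOn (γ N) (γ M) (Icc t₀ (t₀ + N)) := by
    intro N M hNM
    have hNM' : (N : ℝ) ≤ M := by exact_mod_cast hNM
    refine ODE_solution_unique_of_mem_Icc_right (v := fun _ => G) (s := fun _ => univ) (K := K)
      (fun t _ => hG.lipschitzOnWith) (fun t ht => (hγ N t ht).continuousWithinAt) (hright N)
      (fun _ _ => mem_univ _) (fun t ht => ?_) (fun t ht => hright M t ⟨ht.1, by linarith [ht.2]⟩)
      (fun _ _ => mem_univ _) ((hγ0 N).trans (hγ0 M).symm)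
    exact (hγ M t ⟨ht.1, by linarith [ht.2]⟩).continuousWithinAt.mono
      (Icc_subset_Icc_right (by linarith))
  have hglue : ∀ N : ℕ, ∀ t ∈ Icc t₀ (t₀ + N), γ ⌈t - t₀⌉₊ t = γ N t := by
    intro N t ht
    refine huniq _ N (Nat.ceil_le.2 (by linarith [ht.2])) ⟨ht.1, ?_⟩
    linarith [Nat.le_ceil (t - t₀)]
  refine ⟨fun t => γ ⌈t - t₀⌉₊ t, by simpa using hγ0 0, fun t ht => ?_⟩
  obtain ⟨N, hN⟩ := exists_nat_gt (t - t₀)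
  have htN : t ∈ Icc t₀ (t₀ + N) := ⟨ht, by linarith⟩
  have h := (hγ N t htN).congr (fun s hs => hglue N s hs) (hglue N t htN)
  rw [← hglue N t htN] at h
  refine h.mono_of_mem_nhdsWithin ?_
  rw [← Ici_inter_Iic]
  exact inter_mem_nhdsWithin _ (Iic_mem_nhds (by linarith))

end Existence

/-! ### Coercive quadratic forms and contraction -/

section Quadratic

open Set Metric NNReal
open scoped RealInnerProductSpace

variable {E : Type*} [NormedAddCommGroup E] [InnerProductSpace ℝ E]

/-- `M` defines a symmetric quadratic form bounded below by `m ‖v‖²`, with `m > 0`. -/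
structure IsCoerciveForm (M : E →L[ℝ] E) (m : ℝ) : Prop where
  pos : 0 < m
  symm : ∀ v w, ⟪M v, w⟫ = ⟪v, M w⟫
  le : ∀ v, m * ‖v‖ ^ 2 ≤ ⟪M v, v⟫

namespace IsCoerciveForm

theorem nonneg {M : E →L[ℝ] E} {m : ℝ} (hM : IsCoerciveForm M m) (v : E) : 0 ≤ ⟪M v, v⟫ :=
  (mul_nonneg hM.pos.le (sq_nonneg _)).trans (hM.le v)

theorem hasDerivWithinAt {M : E →L[ℝ] E} {m : ℝ} (hM : IsCoerciveForm M m) {x : ℝ → E} {x' : E}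
    {s : Set ℝ} {t : ℝ} (hx : HasDerivWithinAt x x' s t) :
    HasDerivWithinAt (fun t => ⟪M (x t), x t⟫) (2 * ⟪M (x t), x'⟫) s t := by
  have h := (M.hasFDerivAt.comp_hasDerivWithinAt t hx).inner ℝ hx
  refine h.congr_deriv ?_
  simp only [Function.comp_apply]
  rw [hM.symm x', real_inner_comm (M (x t)) x', two_mul]

/-- Passage from exponential decay of the quadratic form to exponential decay of the norm. -/
theorem norm_le_of_decay {M : E →L[ℝ] E} {m : ℝ} (hM : IsCoerciveForm M m) {v w : E} {κ t : ℝ}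
    (h : ⟪M v, v⟫ ≤ ⟪M w, w⟫ * Real.exp (-κ * t)) :
    ‖v‖ ≤ √((‖M‖ + 1) / m) * Real.exp (-(κ / 2) * t) * ‖w‖ := by
  have hm := hM.pos
  refine (pow_le_pow_iff_left₀ (norm_nonneg _) (by positivity) two_ne_zero).1 ?_
  have hw : ⟪M w, w⟫ ≤ (‖M‖ + 1) * ‖w‖ ^ 2 := by
    nlinarith [real_inner_le_norm (M w) w, M.le_opNorm w, norm_nonneg w, sq_nonneg ‖w‖]
  have hexp : Real.exp (-(κ / 2) * t) ^ 2 = Real.exp (-κ * t) := by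
    rw [← Real.exp_nat_mul]; congr 1; push_cast; ring
  rw [mul_pow, mul_pow, hexp, Real.sq_sqrt (by positivity)]
  have h2 : m * ‖v‖ ^ 2 ≤ (‖M‖ + 1) * ‖w‖ ^ 2 * Real.exp (-κ * t) :=
    (hM.le v).trans (h.trans (by gcongr))
  calc ‖v‖ ^ 2 = m * ‖v‖ ^ 2 / m := by field_simp
    _ ≤ (‖M‖ + 1) * ‖w‖ ^ 2 * Real.exp (-κ * t) / m := by gcongr
    _ = _ := by ring

/-- A field whose derivative is uniformly contracting on a convex set is strongly monotone there. -/
theorem inner_sub_le {M : E →L[ℝ] E} {F : E → E} {X : Set E} {κ : ℝ}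
    (hF : Differentiable ℝ F) (hX : Convex ℝ X)
    (h : ∀ x ∈ X, ∀ v, ⟪M v, fderiv ℝ F x v⟫ ≤ -κ * ⟪M v, v⟫) {x y : E} (hx : x ∈ X)
    (hy : y ∈ X) : ⟪M (x - y), F x - F y⟫ ≤ -κ * ⟪M (x - y), x - y⟫ := by
  set w := x - y with hw
  -- Pairing with the fixed vector `M w` makes the scalar mean value inequality sufficient.
  have hd : ∀ s : ℝ, HasDerivAt (fun s : ℝ => ⟪M w, F (y + s • w)⟫)
      ⟪M w, fderiv ℝ F (y + s • w) w⟫ s := by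
    intro s
    have h1 : HasDerivAt (fun s : ℝ => y + s • w) w s := by
      simpa using ((hasDerivAt_id s).smul_const w).const_add y
    have h2 := (hF (y + s • w)).hasFDerivAt.comp_hasDerivAt s h1
    simpa using (hasDerivAt_const s (M w)).inner ℝ h2
  have hmem : ∀ s ∈ Icc (0 : ℝ) 1, y + s • w ∈ X := fun s hs => by
    rw [hw]; exact hX.add_smul_sub_mem hy hx hs
  have := (convex_Icc (0 : ℝ) 1).image_sub_le_mul_sub_of_deriv_le
    (f := fun s : ℝ => ⟪M w, F (y + s • w)⟫) (C := -κ * ⟪M w, w⟫)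
    (fun s _ => (hd s).continuousAt.continuousWithinAt)
    (fun s _ => (hd s).differentiableAt.differentiableWithinAt)
    (fun s hs => by rw [(hd s).deriv]; exact h _ (hmem s (interior_subset hs)) w)
    0 (by simp) 1 (by simp) zero_le_one
  simpa [inner_sub_right, hw] using this

end IsCoerciveForm

end Quadratic

/-! ### Convergence and stability for contracting fields -/

section Solutions

open Set Metric NNReal Filter Topology
open scoped RealInnerProductSpace

variable {n : ℕ} {F : Vec n → Vec n} {t₀ : ℝ} {J : Set ℝ}

namespace IsForwardSolution

theorem Icc_subset {ξ : Vec n} {x : ℝ → Vec n} (hx : IsForwardSolution F t₀ ξ J x) {t : ℝ}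
    (ht : t ∈ J) : Icc t₀ t ⊆ J :=
  hx.ordConnected.out hx.isLeast.1 ht

theorem hasDerivWithinAt_Ici {ξ : Vec n} {x : ℝ → Vec n} (hx : IsForwardSolution F t₀ ξ J x)
    {s t : ℝ} (ht : t ∈ J) (hs : s ∈ Ico t₀ t) : HasDerivWithinAt x (F (x s)) (Ici s) s :=
  (hx.solves s (hx.Icc_subset ht ⟨hs.1, hs.2.le⟩)).mono_of_mem_nhdsWithin
    (mem_of_superset (Icc_mem_nhdsGE hs.2)
      ((Icc_subset_Icc_left hs.1).trans (hx.Icc_subset ht)))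

theorem continuousOn_Icc {ξ : Vec n} {x : ℝ → Vec n} (hx : IsForwardSolution F t₀ ξ J x)
    {t : ℝ} (ht : t ∈ J) : ContinuousOn x (Icc t₀ t) :=
  hx.solves.continuousOn.mono (hx.Icc_subset ht)

/-- Translate of a solution on a half-line. -/
theorem shift {ξ : Vec n} {x : ℝ → Vec n} (hx : IsForwardSolution F 0 ξ (Ici 0) x) {h : ℝ}
    (hh : 0 ≤ h) : IsForwardSolution F 0 (x h) (Ici 0) (fun t => x (t + h)) where
  ordConnected := ordConnected_Ici
  isLeast := isLeast_Ici
  initial := by simp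
  solves := by
    have := (hx.solves.comp_add h).mono (s' := Ici 0) (fun t (ht : 0 ≤ t) => by
      exact ⟨t + h, add_nonneg ht hh, by simp⟩)
    exact this

theorem const {p : Vec n} (hp : F p = 0) : IsForwardSolution F t₀ p (Ici t₀) (fun _ => p) where
  ordConnected := ordConnected_Ici
  isLeast := isLeast_Ici
  initial := rfl
  solves := fun t _ => by simpa [hp] using hasDerivWithinAt_const t (Ici t₀) p

/-- Decay of the quadratic form along the difference of two curves. -/
theorem norm_sub_le {M : Vec n →L[ℝ] Vec n} {m κ r : ℝ} (hM : IsCoerciveForm M m) (hκ : 0 < κ)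
    {ξ η : Vec n} {x y : ℝ → Vec n} {J' : Set ℝ}
    (hx : IsForwardSolution F t₀ ξ J x) (hy : IsForwardSolution F t₀ η J' y)
    (hr : ⟪M (ξ - η), ξ - η⟫ < r) {t : ℝ} (ht : t ∈ J) (ht' : t ∈ J')
    (h : ∀ s ∈ Ico t₀ t, ⟪M (x s - y s), x s - y s⟫ < r →
      ⟪M (x s - y s), F (x s) - F (y s)⟫ ≤ -κ * ⟪M (x s - y s), x s - y s⟫) :
    ‖x t - y t‖ ≤ √((‖M‖ + 1) / m) * Real.exp (-(κ / 2) * (t - t₀)) * ‖ξ - η‖ := by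
  rw [← hx.initial, ← hy.initial] at hr ⊢
  refine hM.norm_le_of_decay ?_
  refine exp_decay (V := fun s => ⟪M (x s - y s), x s - y s⟫)
    (V' := fun s => 2 * ⟪M (x s - y s), F (x s) - F (y s)⟫) (b := t) hκ
    (fun s => hM.nonneg _) ?_ (fun s hs => ?_) hr (fun s hs hsr => ?_) t ⟨hx.isLeast.2 ht, le_rfl⟩
  · have hc := (hx.continuousOn_Icc ht).sub (hy.continuousOn_Icc ht')
    exact (M.continuous.comp_continuousOn hc).inner hc
  · exact hM.hasDerivWithinAt
      ((hx.hasDerivWithinAt_Ici ht hs).sub (hy.hasDerivWithinAt_Ici ht' hs))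
  · have := h s hs hsr
    linarith

end IsForwardSolution

/-- If a continuously differentiable field points strictly into an ellipsoid along its boundary,
solutions starting in the ellipsoid exist for all future time. -/
theorem exists_isForwardSolution_of_inward {M : Vec n →L[ℝ] Vec n} {m ρ : ℝ}
    (hM : IsCoerciveForm M m) (hF : ContDiff ℝ 1 F) (c : Vec n)
    (hin : ∀ x, ⟪M (x - c), x - c⟫ = ρ → ⟪M (x - c), F x⟫ < 0) (t₀ : ℝ) {ξ : Vec n}
    (hξ : ⟪M (ξ - c), ξ - c⟫ ≤ ρ) : ∃ x, IsForwardSolution F t₀ ξ (Ici t₀) x := by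
  have hm := hM.pos
  have hρ : 0 ≤ ρ := (hM.nonneg _).trans hξ
  set R := √(ρ / m) + 1 with hR
  have hRpos : 0 < R := by positivity
  -- The cutoff makes the field bounded and globally Lipschitz. It equals 1 on the ellipsoid, so
  -- solutions trapped there solve the original equation.
  let χ : ContDiffBump c := ⟨R, R + 1, hRpos, by linarith⟩
  have hball : ∀ x, ⟪M (x - c), x - c⟫ ≤ ρ → χ x = 1 := by
    intro x hx
    refine χ.one_of_mem_closedBall ?_
    rw [mem_closedBall_iff_norm]
    have h1 : ‖x - c‖ ^ 2 ≤ ρ / m := by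
      rw [le_div_iff₀ hm]; linarith [hM.le (x - c)]
    exact (Real.le_sqrt_of_sq_le h1).trans (by simp [χ, R])
  have hG : ContDiff ℝ 1 (fun x => χ x • F x) := χ.contDiff.smul hF
  have hsupp : HasCompactSupport (fun x => χ x • F x) := χ.hasCompactSupport.smul_right
  obtain ⟨K, hK⟩ := hG.lipschitzWith_of_hasCompactSupport hsupp one_ne_zero
  obtain ⟨L, hL⟩ := hG.continuous.bounded_above_of_compact_support hsupp
  obtain ⟨x, hx0, hx⟩ := exists_isIntegralCurveOn_Ici hK (L := L.toNNReal)
    (fun y => (hL y).trans (Real.le_coe_toNNReal L)) t₀ ξ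
  have hsol : IsForwardSolution (fun x => χ x • F x) t₀ ξ (Ici t₀) x :=
    ⟨ordConnected_Ici, isLeast_Ici, hx0, hx⟩
  have hstay : ∀ t ∈ Ici t₀, ⟪M (x t - c), x t - c⟫ ≤ ρ := by
    intro t ht
    refine image_le_of_deriv_right_lt_deriv_boundary (a := t₀) (b := t)
      (f := fun s => ⟪M (x s - c), x s - c⟫)
      (f' := fun s => 2 * ⟪M (x s - c), χ (x s) • F (x s)⟫) (B := fun _ => ρ) (B' := fun _ => 0)
      ?_ (fun s hs => ?_) (by rw [hx0]; exact hξ) (fun s => hasDerivAt_const s ρ)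
      (fun s hs hsρ => ?_) ⟨ht, le_rfl⟩
    · have hc := (hsol.continuousOn_Icc ht).sub (continuousOn_const (c := c))
      exact (M.continuous.comp_continuousOn hc).inner hc
    · exact hM.hasDerivWithinAt ((hsol.hasDerivWithinAt_Ici ht hs).sub_const c)
    · have := hin _ hsρ
      rw [hball _ hsρ.le, one_smul]
      linarith
  refine ⟨x, ordConnected_Ici, isLeast_Ici, hx0, fun t ht => ?_⟩
  have := hx t ht
  simp only [hball _ (hstay t ht), one_smul] at this
  exact this

/-- A field that contracts on the whole space is forward complete. -/
theorem forwardComplete_of_contracting {M : Vec n →L[ℝ] Vec n} {m κ : ℝ}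
    (hM : IsCoerciveForm M m) (hκ : 0 < κ) (hF : ContDiff ℝ 1 F)
    (h : ∀ x v, ⟪M v, fderiv ℝ F x v⟫ ≤ -κ * ⟪M v, v⟫) : ForwardComplete F univ := by
  intro t₀ ξ _
  have hm := hM.pos
  -- For `‖x‖ > a` the contraction term dominates the drift `⟪M x, F 0⟫`. The level `ρ` is large
  -- enough to enclose `ξ` and to keep its level set outside the ball of radius `a`.
  set a := ‖M‖ * ‖F 0‖ / (κ * m) with ha
  set ρ := max ⟪M ξ, ξ⟫ ((‖M‖ + 1) * (a + 1) ^ 2) with hρ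
  refine exists_isForwardSolution_of_inward hM hF 0 (ρ := ρ) (fun x hx => ?_) t₀
    (by simp [hρ])
  rw [sub_zero] at hx ⊢
  have hmono := IsCoerciveForm.inner_sub_le (M := M) (hF.differentiable one_ne_zero) convex_univ
    (fun x _ => h x) (mem_univ x) (mem_univ 0)
  rw [sub_zero, inner_sub_right] at hmono
  have hxa : a < ‖x‖ := by
    by_contra! hcon
    have h1 : ⟪M x, x⟫ ≤ ‖M‖ * ‖x‖ ^ 2 := by
      nlinarith [real_inner_le_norm (M x) x, M.le_opNorm x, norm_nonneg x]
    have h2 : (‖M‖ + 1) * (a + 1) ^ 2 ≤ ⟪M x, x⟫ := hx ▸ le_max_right _ _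
    have h3 : ‖x‖ ^ 2 ≤ (a + 1) ^ 2 := by
      gcongr; linarith
    have h4 : 0 < (a + 1) ^ 2 := by
      have : 0 ≤ a := by positivity
      positivity
    nlinarith [norm_nonneg M]
  have hxpos : 0 < ‖x‖ := lt_of_le_of_lt (by positivity) hxa
  have h5 : ⟪M x, F 0⟫ ≤ ‖M‖ * ‖x‖ * ‖F 0‖ :=
    (real_inner_le_norm _ _).trans (by gcongr; exact M.le_opNorm x)
  have h6 : ‖M‖ * ‖F 0‖ < ‖x‖ * (κ * m) := by
    rwa [ha, div_lt_iff₀ (by positivity)] at hxa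
  have h7 : κ * (m * ‖x‖ ^ 2) ≤ κ * ⟪M x, x⟫ := by gcongr; exact hM.le x
  nlinarith

/-- Two solutions in a set on which the field contracts approach each other exponentially. -/
theorem IsForwardSolution.norm_sub_le_of_contracting {M : Vec n →L[ℝ] Vec n} {m κ : ℝ}
    {X : Set (Vec n)} (hM : IsCoerciveForm M m) (hκ : 0 < κ)
    (hmono : ∀ x ∈ X, ∀ y ∈ X, ⟪M (x - y), F x - F y⟫ ≤ -κ * ⟪M (x - y), x - y⟫)
    (hinv : ForwardInvariant F X) {ξ η : Vec n} {x y : ℝ → Vec n} {J' : Set ℝ} (hξ : ξ ∈ X)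
    (hη : η ∈ X) (hx : IsForwardSolution F t₀ ξ J x) (hy : IsForwardSolution F t₀ η J' y)
    {t : ℝ} (ht : t ∈ J) (ht' : t ∈ J') :
    ‖x t - y t‖ ≤ √((‖M‖ + 1) / m) * Real.exp (-(κ / 2) * (t - t₀)) * ‖ξ - η‖ :=
  -- Contraction holds throughout `X`, so any threshold above the initial value will do.
  hx.norm_sub_le hM hκ hy (lt_add_one _) ht ht' fun _ hs _ =>
    hmono _ (hinv _ _ hξ _ _ hx _ (hx.Icc_subset ht ⟨hs.1, hs.2.le⟩)) _
      (hinv _ _ hη _ _ hy _ (hy.Icc_subset ht' ⟨hs.1, hs.2.le⟩))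

/-- A contracting field on a closed invariant set has an equilibrium there. -/
theorem exists_equilibrium {M : Vec n →L[ℝ] Vec n} {m κ : ℝ} {X : Set (Vec n)}
    (hM : IsCoerciveForm M m) (hκ : 0 < κ)
    (hmono : ∀ x ∈ X, ∀ y ∈ X, ⟪M (x - y), F x - F y⟫ ≤ -κ * ⟪M (x - y), x - y⟫)
    (hne : X.Nonempty) (hcl : IsClosed X) (hinv : ForwardInvariant F X)
    (hcomp : ForwardComplete F X) : ∃ p ∈ X, F p = 0 := by
  obtain ⟨ξ, hξ⟩ := hne
  obtain ⟨x, hx⟩ := hcomp 0 ξ hξ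
  have hxX : ∀ t, 0 ≤ t → x t ∈ X := fun t ht => hinv _ _ hξ _ _ hx t ht
  set C := √((‖M‖ + 1) / m) with hC
  have hshift : ∀ h, 0 ≤ h → ∀ k : ℕ,
      ‖x (k + h) - x k‖ ≤ C * ‖x h - ξ‖ * Real.exp (-(κ / 2)) ^ k := by
    intro h hh k
    have hk : (k : ℝ) ∈ Ici (0 : ℝ) := mem_Ici.2 k.cast_nonneg
    have := (hx.shift hh).norm_sub_le_of_contracting hM hκ hmono hinv (hxX h hh) hξ hx hk hk
    rw [← Real.exp_nat_mul]
    calc _ ≤ _ := this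
      _ = _ := by rw [sub_zero, mul_comm (k : ℝ)]; ring
  have hlt : Real.exp (-(κ / 2)) < 1 := Real.exp_lt_one_iff.mpr (by linarith)
  have hcau : CauchySeq fun k : ℕ => x k :=
    cauchySeq_of_le_geometric (Real.exp (-(κ / 2))) (C * ‖x 1 - ξ‖) hlt (fun k => by
      rw [dist_comm, dist_eq_norm]; simpa using hshift 1 zero_le_one k)
  obtain ⟨p, hp⟩ := cauchySeq_tendsto_of_complete hcau
  have hpX : p ∈ X := hcl.mem_of_tendsto hp (.of_forall fun k => hxX _ k.cast_nonneg)
  refine ⟨p, hpX, ?_⟩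
  obtain ⟨y, hy⟩ := hcomp 0 p hpX
  -- The limit is fixed by the flow: `x (k + t)` approaches both `x k`, hence `p`, and `y t`.
  have hyp : ∀ t ∈ Ici (0 : ℝ), y t = p := by
    intro t ht
    have h1 : Tendsto (fun k : ℕ => x (k + t) - x k) atTop (𝓝 0) := by
      refine squeeze_zero_norm (hshift t ht) ?_
      simpa using (tendsto_pow_atTop_nhds_zero_of_lt_one (Real.exp_pos _).le hlt).const_mul
        (C * ‖x t - ξ‖)
    have h2 : Tendsto (fun k : ℕ => x (k + t) - y t) atTop (𝓝 0) := by
      refine squeeze_zero_norm (a := fun k : ℕ => C * Real.exp (-(κ / 2) * (t - 0)) * ‖x k - p‖)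
        (fun k => ?_) ?_
      · have := (hx.shift k.cast_nonneg).norm_sub_le_of_contracting hM hκ hmono hinv
          (hxX k k.cast_nonneg) hpX hy ht ht
        rwa [add_comm t] at this
      · simpa using ((hp.sub_const p).norm).const_mul (C * Real.exp (-(κ / 2) * (t - 0)))
    have h3 := (hp.add h1).sub h2
    simp only [add_zero, sub_zero, add_sub_cancel, sub_sub_cancel] at h3
    exact tendsto_nhds_unique tendsto_const_nhds h3
  have hd : HasDerivWithinAt y (F p) (Ici 0) 0 := by
    have := hy.solves 0 self_mem_Ici
    rwa [hy.initial] at this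
  have hd' : HasDerivWithinAt y 0 (Ici 0) 0 :=
    (hasDerivWithinAt_const 0 (Ici 0) p).congr hyp hy.initial
  exact (uniqueDiffWithinAt_Ici 0).eq_deriv _ hd hd'

/-- Exponential stability of an equilibrium at which the linearization contracts. -/
theorem uniformExpStable_of_fderiv {M : Vec n →L[ℝ] Vec n} {m κ : ℝ} (hM : IsCoerciveForm M m)
    (hκ : 0 < κ) (hF : ContDiff ℝ 1 F) {p : Vec n} (hp : F p = 0)
    (h : ∀ v, ⟪M v, fderiv ℝ F p v⟫ ≤ -κ * ⟪M v, v⟫) : UniformExpStable F p := by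
  have hm := hM.pos
  -- The tolerance is chosen so that perturbing the derivative costs at most half of the rate `κ`.
  obtain ⟨R, hR, hfd⟩ : ∃ R > 0, ∀ x ∈ ball p R,
      ‖fderiv ℝ F x - fderiv ℝ F p‖ < κ / 2 * m / (‖M‖ + 1) := by
    obtain ⟨R, hR, h⟩ := Metric.continuousAt_iff.1
      ((hF.continuous_fderiv one_ne_zero).continuousAt (x := p)) _
      (by positivity : 0 < κ / 2 * m / (‖M‖ + 1))
    exact ⟨R, hR, fun x hx => by rw [← dist_eq_norm]; exact h hx⟩
  have hloc : ∀ x ∈ ball p R, ∀ v, ⟪M v, fderiv ℝ F x v⟫ ≤ -(κ / 2) * ⟪M v, v⟫ := by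
    intro x hx v
    have h1 : ⟪M v, (fderiv ℝ F x - fderiv ℝ F p) v⟫ ≤ κ / 2 * ⟪M v, v⟫ := by
      calc _ ≤ ‖M v‖ * ‖(fderiv ℝ F x - fderiv ℝ F p) v‖ := real_inner_le_norm _ _
        _ ≤ ((‖M‖ + 1) * ‖v‖) * (κ / 2 * m / (‖M‖ + 1) * ‖v‖) := by
          gcongr
          · exact (M.le_opNorm v).trans (by gcongr; linarith)
          · exact (ContinuousLinearMap.le_opNorm _ v).trans (by gcongr; exact (hfd x hx).le)
        _ = κ / 2 * (m * ‖v‖ ^ 2) := by field_simp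
        _ ≤ _ := by gcongr; exact hM.le v
    have h2 := h v
    rw [_root_.sub_apply, inner_sub_right] at h1
    linarith
  have hmono : ∀ x ∈ ball p R, ⟪M (x - p), F x⟫ ≤ -(κ / 2) * ⟪M (x - p), x - p⟫ := by
    intro x hx
    have := IsCoerciveForm.inner_sub_le (hF.differentiable one_ne_zero) (convex_ball p R) hloc hx
      (mem_ball_self hR)
    rwa [hp, sub_zero] at this
  have hell : ∀ x, ⟪M (x - p), x - p⟫ < m * R ^ 2 → x ∈ ball p R := by
    intro x hx
    rw [mem_ball_iff_norm]
    refine lt_of_pow_lt_pow_left₀ 2 hR.le ?_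
    nlinarith [hM.le (x - p)]
  set ρ := m * R ^ 2 / 2 with hρ
  have hρpos : 0 < ρ := by positivity
  have hρlt : ρ < m * R ^ 2 := by linarith
  have hδ : 0 < √(ρ / (‖M‖ + 1)) := by positivity
  have hsmall : ∀ ξ ∈ ball p √(ρ / (‖M‖ + 1)), ⟪M (ξ - p), ξ - p⟫ < ρ := by
    intro ξ hξ
    rw [mem_ball_iff_norm, Real.lt_sqrt (norm_nonneg _), lt_div_iff₀ (by positivity)] at hξ
    nlinarith [real_inner_le_norm (M (ξ - p)) (ξ - p), M.le_opNorm (ξ - p), norm_nonneg (ξ - p),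
      sq_nonneg ‖ξ - p‖]
  -- One halving of `κ` pays for the perturbation of the derivative, the other for the square root
  -- from `V` to the norm.
  refine ⟨_, hδ, fun t₀ ξ hξ => ?_, √((‖M‖ + 1) / m), by positivity, κ / 2 / 2, by positivity,
    fun t₀ ξ hξ J x hx t ht => ?_⟩
  · refine exists_isForwardSolution_of_inward hM hF p (fun x hx => ?_) t₀ (hsmall ξ hξ).le
    have := hmono x (hell x (hx.trans_lt hρlt))
    rw [hx] at this
    nlinarith
  · refine hx.norm_sub_le hM (half_pos hκ) (.const hp) ((hsmall ξ hξ).trans hρlt) ht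
      (hx.isLeast.2 ht) (fun s _ hs' => ?_)
    rw [hp, sub_zero]
    exact hmono _ (hell _ hs')

/-- Existence, uniqueness and exponential stability of the equilibrium of a contracting field. -/
theorem exists_unique_stable_equilibrium {M : Vec n →L[ℝ] Vec n} {m κ : ℝ} {X : Set (Vec n)}
    (hM : IsCoerciveForm M m) (hκ : 0 < κ) (hF : ContDiff ℝ 1 F)
    (h : ∀ x ∈ X, ∀ v, ⟪M v, fderiv ℝ F x v⟫ ≤ -κ * ⟪M v, v⟫)
    (hX : (X.Nonempty ∧ Convex ℝ X ∧ IsClosed X ∧ ForwardInvariant F X ∧ ForwardComplete F X) ∨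
      X = Set.univ) :
    ∃ p ∈ X, F p = 0 ∧ (∀ y ∈ X, F y = 0 → y = p) ∧
      UniformExpStable F p ∧ UniformExpConverges F X p := by
  have hX' : X.Nonempty ∧ Convex ℝ X ∧ IsClosed X ∧ ForwardInvariant F X ∧
      ForwardComplete F X := by
    rcases hX with hX | rfl
    · exact hX
    · exact ⟨univ_nonempty, convex_univ, isClosed_univ, fun _ _ _ _ _ _ _ _ => mem_univ _,
        forwardComplete_of_contracting hM hκ hF fun x => h x (mem_univ x)⟩
  obtain ⟨hne, hconv, hcl, hinv, hcomp⟩ := hX'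
  have hmono : ∀ x ∈ X, ∀ y ∈ X, ⟪M (x - y), F x - F y⟫ ≤ -κ * ⟪M (x - y), x - y⟫ :=
    fun x hx y hy => IsCoerciveForm.inner_sub_le (hF.differentiable one_ne_zero) hconv h hx hy
  have hm := hM.pos
  obtain ⟨p, hpX, hp⟩ := exists_equilibrium hM hκ hmono hne hcl hinv hcomp
  refine ⟨p, hpX, hp, fun y hy hFy => ?_, uniformExpStable_of_fderiv hM hκ hF hp (h p hpX),
    hcomp, √((‖M‖ + 1) / m), by positivity, κ / 2, by positivity,
    fun t₀ ξ hξ J x hx t ht => ?_⟩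
  · have h1 := hmono y hy p hpX
    rw [hFy, hp, sub_zero, inner_zero_right] at h1
    have h2 : m * ‖y - p‖ ^ 2 ≤ 0 := (hM.le _).trans (by nlinarith)
    have h3 : ‖y - p‖ ^ 2 = 0 := le_antisymm (by nlinarith) (sq_nonneg _)
    exact sub_eq_zero.1 (norm_eq_zero.1 (pow_eq_zero_iff two_ne_zero |>.1 h3))
  · exact hx.norm_sub_le_of_contracting hM hκ hmono hinv hξ hpX (.const hp) ht (hx.isLeast.2 ht)

end Solutions

/-! ### From the matrix inequality to contraction -/

section ClosedLoop

open scoped RealInnerProductSpace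

variable {n m q τ T : ℕ}

theorem fderiv_ofLp_eq_jacobian_mulVec (Q : Vec n → Vec q) (x v : Vec n) :
    (fderiv ℝ Q x v).ofLp = jacobian Q x *ᵥ v.ofLp := by
  ext i
  have hv : v = ∑ j, v j • EuclideanSpace.single j (1 : ℝ) := by
    simpa using ((EuclideanSpace.basisFun (Fin n) ℝ).sum_repr v).symm
  conv_lhs => rw [hv]
  simp [map_sum, jacobian, mulVec, dotProduct, mul_comm]

theorem inner_eq_dotProduct {k : ℕ} (v w : Vec k) : ⟪v, w⟫ = v.ofLp ⬝ᵥ w.ofLp := by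
  rw [EuclideanSpace.inner_eq_star_dotProduct, dotProduct_comm]; simp

/-- The linear matrix inequality, tested on the vector `(a, b, c)`. -/
theorem lmiMatrix_quadratic (X₁ : Matrix (Fin n) (Fin T) ℝ) (RQ : Matrix (Fin n) (Fin τ) ℝ)
    (P : Matrix (Fin n) (Fin n) ℝ) (Y₁ : Matrix (Fin T) (Fin n) ℝ)
    (G₂ : Matrix (Fin T) (Fin q) ℝ) (α : ℝ) (a : Fin n → ℝ) (b : Fin q → ℝ) (c : Fin τ → ℝ) :
    Sum.elim (Sum.elim a b) c ⬝ᵥ (lmiMatrix X₁ RQ P Y₁ G₂ α *ᵥ Sum.elim (Sum.elim a b) c) =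
      2 * (a ⬝ᵥ ((X₁ * Y₁) *ᵥ a)) + α * (a ⬝ᵥ a) + 2 * (a ⬝ᵥ ((X₁ * G₂) *ᵥ b)) - b ⬝ᵥ b
        + 2 * (c ⬝ᵥ ((RQᵀ * P) *ᵥ a)) - c ⬝ᵥ c := by
  have e1 : a ⬝ᵥ ((X₁ * Y₁)ᵀ *ᵥ a) = a ⬝ᵥ ((X₁ * Y₁) *ᵥ a) := by
    rw [mulVec_transpose, dotProduct_comm, dotProduct_mulVec]
  have e2 : b ⬝ᵥ ((G₂ᵀ * X₁ᵀ) *ᵥ a) = a ⬝ᵥ ((X₁ * G₂) *ᵥ b) := by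
    rw [← transpose_mul, mulVec_transpose, dotProduct_comm, dotProduct_mulVec]
  have e3 : a ⬝ᵥ ((RQᵀ * P)ᵀ *ᵥ c) = c ⬝ᵥ ((RQᵀ * P) *ᵥ a) := by
    rw [mulVec_transpose, dotProduct_comm, dotProduct_mulVec]
  have e4 : (G₂ᵀ * X₁ᵀ)ᵀ = X₁ * G₂ := by rw [← transpose_mul, transpose_transpose]
  have el : ∀ (u u' : Fin n → ℝ) (w w' : Fin q → ℝ),
      Sum.elim u w + Sum.elim u' w' = Sum.elim (u + u') (w + w') := fun u u' w w' => by
    ext (i | i) <;> rfl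
  simp only [lmiMatrix, fromBlocks_mulVec, Sum.elim_comp_inl, Sum.elim_comp_inr,
    fromRows_mulVec, fromCols_mulVec_sumElim, sumElim_dotProduct_sumElim, zero_mulVec, add_zero,
    neg_mulVec, one_mulVec, el, dotProduct_add, dotProduct_neg, add_mulVec, smul_mulVec,
    dotProduct_smul, smul_eq_mul, e1, e2, e3, e4]
  ring

theorem SDPFeasible.quadratic_le {X₁ : Matrix (Fin n) (Fin T) ℝ}
    {Z₀ : Matrix (Fin n ⊕ Fin q) (Fin T) ℝ} {RQ : Matrix (Fin n) (Fin τ) ℝ}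
    {P : Matrix (Fin n) (Fin n) ℝ} {Y₁ : Matrix (Fin T) (Fin n) ℝ} {G₂ : Matrix (Fin T) (Fin q) ℝ}
    {α : ℝ} (h : SDPFeasible X₁ Z₀ RQ P Y₁ G₂ α) (D : Matrix (Fin q) (Fin n) ℝ)
    (hD : (RQ * RQᵀ - Dᵀ * D).PosSemidef) (v : Fin n → ℝ) :
    2 * ((P⁻¹ *ᵥ v) ⬝ᵥ ((X₁ * Y₁ * P⁻¹) *ᵥ v + (X₁ * G₂) *ᵥ (D *ᵥ v))) ≤
      -α * ((P⁻¹ *ᵥ v) ⬝ᵥ (P⁻¹ *ᵥ v)) := by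
  have hdet : IsUnit P.det := h.posDef.det_pos.ne'.isUnit
  -- A Schur complement in vector form: with `a = P⁻¹v`, `b = Dv`, `c = RQᵀv`, the last two blocks
  -- leave `|RQᵀv|² - |Dv|²`, which is nonnegative by `hD` and can be dropped.
  have h1 := h.lmi.dotProduct_mulVec_nonneg
    (Sum.elim (Sum.elim (P⁻¹ *ᵥ v) (D *ᵥ v)) (RQᵀ *ᵥ v))
  rw [star_trivial, neg_mulVec, dotProduct_neg, lmiMatrix_quadratic] at h1
  have h2 := hD.dotProduct_mulVec_nonneg v
  have sq : ∀ {k : ℕ} (N : Matrix (Fin k) (Fin n) ℝ),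
      v ⬝ᵥ ((Nᵀ * N) *ᵥ v) = (N *ᵥ v) ⬝ᵥ (N *ᵥ v) := fun N => by
    rw [← mulVec_mulVec, dotProduct_mulVec, vecMul_transpose]
  have sqR := sq RQᵀ
  rw [transpose_transpose] at sqR
  rw [star_trivial, sub_mulVec, dotProduct_sub, sq, sqR] at h2
  have e1 : (RQᵀ * P) *ᵥ (P⁻¹ *ᵥ v) = RQᵀ *ᵥ v := by
    rw [mulVec_mulVec, Matrix.mul_assoc, mul_nonsing_inv _ hdet, Matrix.mul_one]
  have e2 : (X₁ * Y₁ * P⁻¹) *ᵥ v = (X₁ * Y₁) *ᵥ (P⁻¹ *ᵥ v) := by rw [mulVec_mulVec]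
  rw [e1] at h1
  rw [e2, dotProduct_add]
  linarith

/-- The inverse of a positive definite matrix defines a coercive quadratic form. -/
theorem isCoerciveForm_inv {P : Matrix (Fin n) (Fin n) ℝ} (hP : P.PosDef) :
    ∃ m, IsCoerciveForm (toEuclideanCLM (𝕜 := ℝ) P⁻¹) m ∧
      ∃ κ > 0, ∀ v : Vec n, κ * ⟪toEuclideanCLM (𝕜 := ℝ) P⁻¹ v, v⟫ ≤
        ‖toEuclideanCLM (𝕜 := ℝ) P⁻¹ v‖ ^ 2 := by
  have hdet : IsUnit P.det := hP.det_pos.ne'.isUnit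
  set M := toEuclideanCLM (𝕜 := ℝ) P⁻¹ with hM
  set N := toEuclideanCLM (𝕜 := ℝ) P with hN
  have hNM : ∀ v, N (M v) = v := fun v => by
    rw [← mul_apply_eq_comp, ← map_mul, mul_nonsing_inv _ hdet, map_one]; rfl
  have hsym : ∀ v w, ⟪M v, w⟫ = ⟪v, M w⟫ := fun v w => by
    have hT : (P⁻¹)ᵀ = P⁻¹ := by simpa using hP.inv.isHermitian.eq
    rw [inner_eq_dotProduct, inner_eq_dotProduct, hM, ofLp_toEuclideanCLM, ofLp_toEuclideanCLM,
      dotProduct_mulVec, ← mulVec_transpose, hT]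
  have hup : ∀ v, ⟪M v, v⟫ ≤ ‖N‖ * ‖M v‖ ^ 2 := fun v => by
    calc ⟪M v, v⟫ = ⟪M v, N (M v)⟫ := by rw [hNM]
      _ ≤ ‖M v‖ * (‖N‖ * ‖M v‖) :=
        (real_inner_le_norm _ _).trans (by gcongr; exact N.le_opNorm _)
      _ = _ := by ring
  obtain ⟨m, hm, hle⟩ : ∃ m > 0, ∀ v : Vec n, m * ‖v‖ ^ 2 ≤ ⟪M v, v⟫ := by
    -- Positivity on the compact unit sphere gives a uniform lower bound, extended by homogeneity.
    obtain ⟨m, hm, hle⟩ := (isCompact_sphere (0 : Vec n) 1).exists_forall_le' (a := 0)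
      (f := fun v => ⟪M v, v⟫) (M.continuous.inner continuous_id).continuousOn (fun v hv => by
        have hv0 : v.ofLp ≠ 0 := fun h => by
          have h0 : v = 0 := by ext i; simp [h]
          simp [h0] at hv
        have := hP.inv.dotProduct_mulVec_pos hv0
        rwa [star_trivial, dotProduct_comm, ← ofLp_toEuclideanCLM, ← inner_eq_dotProduct] at this)
    refine ⟨m, hm, fun v => ?_⟩
    rcases eq_or_ne v 0 with rfl | hv
    · simp
    have hn : 0 < ‖v‖ := norm_pos_iff.2 hv
    have h := hle (‖v‖⁻¹ • v) (by simp [norm_smul, hn.ne'])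
    rw [map_smul, inner_smul_left, inner_smul_right] at h
    calc m * ‖v‖ ^ 2 ≤ ‖v‖⁻¹ * (‖v‖⁻¹ * ⟪M v, v⟫) * ‖v‖ ^ 2 := by gcongr; simpa using h
      _ = _ := by field_simp
  -- The summand 1 covers `‖N‖ = 0`, which occurs when `n = 0`.
  refine ⟨m, ⟨hm, hsym, hle⟩, (‖N‖ + 1)⁻¹, by positivity, fun v => ?_⟩
  rw [inv_mul_le_iff₀ (by positivity)]
  nlinarith [hup v, sq_nonneg ‖M v‖]

theorem sampleMatrix_eq {f : Vec n → Vec n} {Q : Vec n → Vec q}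
    {A : Matrix (Fin n) (Fin n ⊕ Fin q) ℝ} {B : Matrix (Fin n) (Fin m) ℝ}
    (hf : ∀ x, f x = WithLp.toLp 2 (A *ᵥ dictionary Q x))
    {xs : Fin T → Vec n} {us : Fin T → Vec m} {dxs : Fin T → Vec n}
    (hdata : ∀ i, dxs i = f (xs i) + WithLp.toLp 2 (B *ᵥ (us i).ofLp)) :
    sampleMatrix dxs = A * dictionaryMatrix Q xs + B * sampleMatrix us := by
  ext i t
  simp [sampleMatrix, hdata, hf, dictionaryMatrix, mul_apply, mulVec, dotProduct]

/-- Data-based representation of the closed loop. -/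
theorem add_mul_gain_eq {A : Matrix (Fin n) (Fin n ⊕ Fin q) ℝ} {B : Matrix (Fin n) (Fin m) ℝ}
    {X₁ : Matrix (Fin n) (Fin T) ℝ} {Z₀ : Matrix (Fin n ⊕ Fin q) (Fin T) ℝ}
    {U₀ : Matrix (Fin m) (Fin T) ℝ} {RQ : Matrix (Fin n) (Fin τ) ℝ}
    {P : Matrix (Fin n) (Fin n) ℝ} {Y₁ : Matrix (Fin T) (Fin n) ℝ} {G₂ : Matrix (Fin T) (Fin q) ℝ}
    {α : ℝ} (hX₁ : X₁ = A * Z₀ + B * U₀) (h : SDPFeasible X₁ Z₀ RQ P Y₁ G₂ α) :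
    A + B * gain U₀ P Y₁ G₂ = fromCols (X₁ * Y₁ * P⁻¹) (X₁ * G₂) := by
  have hdet : IsUnit P.det := h.posDef.det_pos.ne'.isUnit
  have hZ : Z₀ * fromCols (Y₁ * P⁻¹) G₂ = 1 := by
    rw [mul_fromCols, ← Matrix.mul_assoc, h.consistency_left, h.consistency_right, fromRows_mul,
      Matrix.zero_mul, mul_nonsing_inv _ hdet, fromCols_fromRows_eq_fromBlocks, fromBlocks_one]
  rw [Matrix.mul_assoc X₁, ← mul_fromCols, hX₁, Matrix.add_mul, Matrix.mul_assoc, hZ,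
    Matrix.mul_one, gain, Matrix.mul_assoc]

end ClosedLoop

open scoped RealInnerProductSpace in
theorem corollary2 {n m q τ T : ℕ}
    -- the plant, with its dictionary representation
    (f : Vec n → Vec n) (Q : Vec n → Vec q) (hQ : ContDiff ℝ 1 Q)
    (A : Matrix (Fin n) (Fin n ⊕ Fin q) ℝ) (B : Matrix (Fin n) (Fin m) ℝ)
    (hf : ∀ x, f x = WithLp.toLp 2 (A *ᵥ dictionary Q x))
    -- the dataset
    (xs : Fin T → Vec n) (us : Fin T → Vec m) (dxs : Fin T → Vec n)
    (hdata : ∀ i, dxs i = f (xs i) + WithLp.toLp 2 (B *ᵥ (us i).ofLp))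
    -- the bound on the Jacobian of the nonlinearities on the set `X`
    (RQ : Matrix (Fin n) (Fin τ) ℝ) (X : Set (Vec n)) (hRQ : JacobianBound Q RQ X)
    -- a feasible point of the semidefinite program
    (P : Matrix (Fin n) (Fin n) ℝ) (Y₁ : Matrix (Fin T) (Fin n) ℝ)
    (G₂ : Matrix (Fin T) (Fin q) ℝ) (α : ℝ)
    (hSDP : SDPFeasible (sampleMatrix dxs) (dictionaryMatrix Q xs) RQ P Y₁ G₂ α)
    -- the closed loop
    (K : Matrix (Fin m) (Fin n ⊕ Fin q) ℝ) (hK : K = gain (sampleMatrix us) P Y₁ G₂)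
    (F : Vec n → Vec n) (hF : F = closedLoop A B K Q)
    (hX : (X.Nonempty ∧ Convex ℝ X ∧ IsClosed X ∧ ForwardInvariant F X ∧ ForwardComplete F X) ∨
      X = Set.univ) :
    ∃ p ∈ X, F p = 0 ∧ (∀ y ∈ X, F y = 0 → y = p) ∧
      UniformExpStable F p ∧ UniformExpConverges F X p := by

  subst hK hF
  set X₁ := sampleMatrix dxs
  set N₁ := (toLpLin 2 2 (X₁ * Y₁ * P⁻¹)).toContinuousLinearMap with hN₁
  set N₂ := (toLpLin 2 2 (X₁ * G₂)).toContinuousLinearMap with hN₂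
  have hF : closedLoop A B (gain (sampleMatrix us) P Y₁ G₂) Q = fun x => N₁ x + N₂ (Q x) := by
    ext x i
    have hd : dictionary Q x = Sum.elim x.ofLp (Q x).ofLp := rfl
    simp [closedLoop, add_mul_gain_eq (sampleMatrix_eq hf hdata) hSDP, hd,
      hN₁, hN₂, X₁, Matrix.mul_assoc]
  have hFd : ∀ x v, fderiv ℝ (closedLoop A B (gain (sampleMatrix us) P Y₁ G₂) Q) x v =
      N₁ v + N₂ (fderiv ℝ Q x v) := by
    intro x v
    have := N₁.hasFDerivAt.add (N₂.hasFDerivAt.comp x (hQ.differentiable one_ne_zero x).hasFDerivAt)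
    rw [hF]
    exact congrArg (· v) this.fderiv
  obtain ⟨m', hM, κ, hκ, hle⟩ := isCoerciveForm_inv hSDP.posDef
  have hα := hSDP.alpha_pos
  -- The rate combines `α‖P⁻¹v‖² ≥ ακ⟪P⁻¹v, v⟫` with the factor 2 on the left of
  -- `SDPFeasible.quadratic_le`.
  refine exists_unique_stable_equilibrium hM (κ := α * κ / 2) (by positivity) ?_
    (fun x hx v => ?_) hX
  · rw [hF]
    exact N₁.contDiff.add (N₂.contDiff.comp hQ)
  · have h := hSDP.quadratic_le (jacobian Q x) (hRQ x hx) v.ofLp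
    have h2 := mul_le_mul_of_nonneg_left (hle v) hα.le
    rw [← real_inner_self_eq_norm_sq] at h2
    rw [hFd, inner_eq_dotProduct]
    rw [inner_eq_dotProduct (toEuclideanCLM (𝕜 := ℝ) P⁻¹ v) (toEuclideanCLM (𝕜 := ℝ) P⁻¹ v)] at h2
    simp only [ofLp_toEuclideanCLM, WithLp.ofLp_add, hN₁, hN₂,
      LinearMap.coe_toContinuousLinearMap', toLpLin_apply,
      fderiv_ofLp_eq_jacobian_mulVec] at h h2 ⊢
    linarith
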